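/- For $n\ge 1$ let $\mathcal U_{nc}(n)$ be the universal unital $C^*$-algebra generated by elements $u_{ij}$ ($1\le i,j\le n$) subject to the relation that $(u_{ij})$ is a unitary matrix, and let $\mathcal V_n=\operatorname{span}\{1,u_{ij},u_{ij}^*\}\subseteq\mathcal U_{nc}(n)$; the generators of $\mathcal V_m$ are denoted $v_{k\ell}$. For operator systems $\mathcal S,\mathcal T$ (self-adjoint unital subspaces of unital $C^*$-algebras), the operator systems $\mathcal S\otimes_c\mathcal T$ and $\mathcal S\otimes_{\max}\mathcal T$ are the algebraic tensor product $\mathcal S\otimes\mathcal T$ with unit $1\otimes 1$, involution $(s\otimes t)^*=s^*\otimes t^*$ and the following matrix cones. A self-adjoint $X\in M_p(\mathcal S\otimes\mathcal T)$ is positive in $M_p(\mathcal S\otimes_c\mathcal T)$ iff $(\varphi\cdot\psi)^{(p)}(X)\ge 0$ for all unital completely positive maps $\varphi:\mathcal S\to\mathcal B(\mathcal H)$, $\psi:\mathcal T\to\mathcal B(\mathcal H)$ with commuting ranges, $\mathcal H$ any Hilbert space, where $(\varphi\cdot\psi)(s\otimes t)=\varphi(s)\psi(t)$. It is positive in $M_p(\mathcal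 S\otimes_{\max}\mathcal T)$ iff for every $\varepsilon>0$ there are $k,l$, $P\in M_k(\mathcal S)_+$, $Q\in M_l(\mathcal T)_+$ and a linear map $L:\mathbb C^p\to\mathbb C^k\otimes\mathbb C^l$ with $X+\varepsilon I_p=L^*(P\otimes Q)L$, where $I_p\in M_p(\mathcal S\otimes\mathcal T)$ is the diagonal matrix with entries $1\otimes1$. A state is a unital positive linear functional. Let $B_{qc}(n,m)$ be the set of all families $(\langle U_{ij}V_{k\ell}\psi,\psi\rangle)_{(i,j),(k,\ell)}$, where $\mathcal H$ is a Hilbert space, $\psi\in\mathcal H$ is a unit vector, and $U=(U_{ij})\in M_n(\mathcal B(\mathcal H))$, $V=(V_{k\ell})\in M_m(\mathcal B(\mathcal H))$ are unitary with $XY=YX$ for all $X\in\{I\}\cup\{U_{ij},U_{ij}^*\}$ and $Y\in\{I\}\cup\{V_{k\ell},V_{k\ell}^*\}$. Let $B_{qmax}(n,m)$ be the set of all families $(s(u_{ij}\otimes v_{k\ell}))_{(i,j),(k,\ell)}$, where $s$ is a state on $\mathcal V_n\otimes_{\max}\mathcal V_m$. Then for all $n,m\ge 2$: $B_{qc}(n,m)\ne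 B_{qmax}(n,m)$; the operator system structures $\mathcal V_n\otimes_c\mathcal V_m$ and $\mathcal V_n\otimes_{\max}\mathcal V_m$ on $\mathcal V_n\otimes\mathcal V_m$ are different; and the identity map $\mathcal V_n\otimes_c\mathcal V_m\to\mathcal V_n\otimes_{\max}\mathcal V_m$ is not even $1$-positive, i.e. there is a positive element of $\mathcal V_n\otimes_c\mathcal V_m$ that is not positive in $\mathcal V_n\otimes_{\max}\mathcal V_m$. -/

import Mathlib

open scoped TensorProduct Matrix ComplexOrder

noncomputable section

namespace UnitaryCorr

/-! ### The universal C*-algebra of a unitary matrix -/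

/-- A unitary `n × n` matrix with entries in some nonzero unital C*-algebra. A C*-algebra generated
by the entries of such a matrix has at most continuum many elements, so up to isomorphism every
C*-algebra generated by such a matrix lives in `Type`. -/
structure UnitaryRep (n : ℕ) : Type 1 where
  alg : Type
  [cstar : CStarAlgebra alg]
  [nontriv : Nontrivial alg]
  mat : Matrix (Fin n) (Fin n) alg
  star_mul_self : matᴴ * mat = 1
  mul_star_self : mat * matᴴ = 1

attribute [instance] UnitaryRep.cstar UnitaryRep.nontriv

/-- The `ℓ^∞`-product of all the C*-algebras carrying a unitary `n × n` matrix. -/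
def RepProd (n : ℕ) : Type 1 := lp (fun r : UnitaryRep n => r.alg) ⊤

instance (n : ℕ) : CStarAlgebra (RepProd n) :=
  letI _ : CStarAlgebra (lp (fun r : UnitaryRep n => r.alg) ⊤) :=
    { toNormedRing := lp.inftyNormedRing
      toStarRing := lp.inftyStarRing
      toCompleteSpace := inferInstance
      toCStarRing := lp.inftyCStarRing
      toNormedAlgebra := lp.inftyNormedAlgebra
      toStarModule := inferInstance }
  inferInstanceAs (CStarAlgebra (lp (fun r : UnitaryRep n => r.alg) ⊤))

/-- The projection of the product onto one of its factors. -/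
def RepProd.eval {n : ℕ} (r : UnitaryRep n) : RepProd n →⋆ₐ[ℂ] r.alg where
  toFun x := x.1 r
  map_one' := rfl
  map_mul' _ _ := rfl
  map_zero' := rfl
  map_add' _ _ := rfl
  commutes' _ := rfl
  map_star' _ := rfl

lemma RepProd.ext {n : ℕ} {x y : RepProd n} (h : ∀ r, RepProd.eval r x = RepProd.eval r y) :
    x = y :=
  Subtype.ext (funext h)

lemma UnitaryRep.norm_mat_le {n : ℕ} (r : UnitaryRep n) (i j : Fin n) : ‖r.mat i j‖ ≤ 1 := by
  let _ : PartialOrder r.alg := CStarAlgebra.spectralOrder r.alg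
  have : StarOrderedRing r.alg := CStarAlgebra.spectralOrderedRing r.alg
  have h : ∑ k, star (r.mat k j) * r.mat k j = 1 := by
    have := congrFun (congrFun r.star_mul_self j) j
    simpa [Matrix.mul_apply, Matrix.conjTranspose_apply] using this
  have h1 : star (r.mat i j) * r.mat i j ≤ 1 := by
    rw [← h]
    exact Finset.single_le_sum (f := fun k => star (r.mat k j) * r.mat k j)
      (fun k _ => star_mul_self_nonneg _) (Finset.mem_univ i)
  have h2 : ‖star (r.mat i j) * r.mat i j‖ ≤ 1 := by
    have := CStarAlgebra.norm_le_norm_of_nonneg_of_le (star_mul_self_nonneg (r.mat i j)) h1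
    simpa using this
  rw [CStarRing.norm_star_mul_self] at h2
  nlinarith [norm_nonneg (r.mat i j)]

/-- The generators, as elements of the product. -/
def RepProd.gen {n : ℕ} (i j : Fin n) : RepProd n :=
  ⟨fun r => r.mat i j, memℓp_infty ⟨1, by rintro _ ⟨r, rfl⟩; exact r.norm_mat_le i j⟩⟩

/-- The closed *-subalgebra generated by the generators. -/
def uncSubalgebra (n : ℕ) : StarSubalgebra ℂ (RepProd n) :=
  (StarAlgebra.adjoin ℂ (Set.range fun p : Fin n × Fin n => RepProd.gen p.1 p.2)).topologicalClosure

/-- `U_nc(n)`, the universal unital C*-algebra generated by the entries of a unitary `n × n`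
matrix. -/
def Unc (n : ℕ) : Type 1 := uncSubalgebra n

instance (n : ℕ) : CStarAlgebra (Unc n) :=
  haveI : IsClosed (uncSubalgebra n : Set (RepProd n)) :=
    StarSubalgebra.isClosed_topologicalClosure _
  inferInstanceAs (CStarAlgebra (uncSubalgebra n))

lemma RepProd.gen_mem {n : ℕ} (i j : Fin n) : RepProd.gen i j ∈ uncSubalgebra n :=
  StarSubalgebra.le_topologicalClosure _ (StarAlgebra.subset_adjoin ℂ _ ⟨(i, j), rfl⟩)

/-- The canonical generators `u i j` of `U_nc(n)`. -/
def Unc.u {n : ℕ} (i j : Fin n) : Unc n := ⟨RepProd.gen i j, RepProd.gen_mem i j⟩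

/-- The representation of `U_nc(n)` given by a unitary matrix. -/
def Unc.rep {n : ℕ} (r : UnitaryRep n) : Unc n →⋆ₐ[ℂ] r.alg :=
  (RepProd.eval r).comp (uncSubalgebra n).subtype

lemma Unc.rep_u {n : ℕ} (r : UnitaryRep n) (i j : Fin n) : Unc.rep r (Unc.u i j) = r.mat i j := rfl

lemma Unc.ext_rep {n : ℕ} {x y : Unc n} (h : ∀ r, Unc.rep r x = Unc.rep r y) : x = y :=
  Subtype.ext (RepProd.ext h)

/-- The matrix of generators is unitary. -/
theorem Unc.u_unitary (n : ℕ) :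
    (Matrix.of (Unc.u (n := n)))ᴴ * Matrix.of Unc.u = 1 ∧
      Matrix.of (Unc.u (n := n)) * (Matrix.of Unc.u)ᴴ = 1 := by
  constructor
  · ext i j
    refine Unc.ext_rep fun r => ?_
    have := congrFun (congrFun r.star_mul_self i) j
    simp only [Matrix.mul_apply, Matrix.conjTranspose_apply, Matrix.of_apply, map_sum, map_mul,
      map_star, Unc.rep_u, Matrix.one_apply] at this ⊢
    rw [this]
    split_ifs <;> simp
  · ext i j
    refine Unc.ext_rep fun r => ?_
    have := congrFun (congrFun r.mul_star_self i) j
    simp only [Matrix.mul_apply, Matrix.conjTranspose_apply, Matrix.of_apply, map_sum, map_mul,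
      map_star, Unc.rep_u, Matrix.one_apply] at this ⊢
    rw [this]
    split_ifs <;> simp

/-- The universal property of `U_nc(n)`. -/
theorem Unc.universal {n : ℕ} {A : Type} [CStarAlgebra A] (a : Matrix (Fin n) (Fin n) A)
    (h₁ : aᴴ * a = 1) (h₂ : a * aᴴ = 1) :
    ∃! π : Unc n →⋆ₐ[ℂ] A, ∀ i j, π (Unc.u i j) = a i j := by
  refine existsUnique_of_exists_of_unique ?_ ?_
  · rcases subsingleton_or_nontrivial A with hA | hA
    · exact ⟨{ toFun := fun _ => 0
               map_one' := Subsingleton.elim _ _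
               map_mul' := fun _ _ => Subsingleton.elim _ _
               map_zero' := Subsingleton.elim _ _
               map_add' := fun _ _ => Subsingleton.elim _ _
               commutes' := fun _ => Subsingleton.elim _ _
               map_star' := fun _ => Subsingleton.elim _ _ }, fun _ _ => Subsingleton.elim _ _⟩
    · exact ⟨Unc.rep ⟨A, a, h₁, h₂⟩, fun _ _ => rfl⟩
  · intro π σ hπ hσ
    have key : ∀ τ : Unc n →⋆ₐ[ℂ] A, Continuous τ := fun τ =>
      AddMonoidHomClass.continuous_of_bound τ 1 fun x => by
        simpa using NonUnitalStarAlgHom.norm_apply_le τ x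
    refine StarAlgHom.ext_topologicalClosure (S := StarAlgebra.adjoin ℂ
      (Set.range fun p : Fin n × Fin n => RepProd.gen p.1 p.2)) (φ := π) (ψ := σ)
      (key π) (key σ) ?_
    refine StarAlgHom.ext_adjoin (s := Set.range fun p : Fin n × Fin n => RepProd.gen p.1 p.2) ?_
    rintro ⟨x, hx⟩ ⟨⟨i, j⟩, hp⟩
    have hp' : RepProd.gen i j = x := hp
    subst hp'
    exact (hπ i j).trans (hσ i j).symm

/-! ### Operator systems -/

/-- Positivity in `M_p(A)` for a C*-algebra `A`: an element of `M_p(A)` is positive if and only if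
it has the form `Y* Y`. -/
def IsMatPos {A : Type*} [Ring A] [StarRing A] {p : ℕ} (X : Matrix (Fin p) (Fin p) A) : Prop :=
  ∃ Y : Matrix (Fin p) (Fin p) A, X = Yᴴ * Y

/-- An operator system in a unital C*-algebra: a self-adjoint subspace containing the unit. -/
structure OpSystem (A : Type*) [CStarAlgebra A] extends Submodule ℂ A where
  one_mem' : (1 : A) ∈ carrier
  star_mem' : ∀ {a : A}, a ∈ carrier → star a ∈ carrier

variable {A B : Type*} [CStarAlgebra A] [CStarAlgebra B]

instance (S : OpSystem A) : One S.toSubmodule := ⟨⟨1, S.one_mem'⟩⟩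

instance (S : OpSystem A) : StarAddMonoid S.toSubmodule where
  star a := ⟨star a.1, S.star_mem' a.2⟩
  star_involutive a := Subtype.ext (star_star a.1)
  star_add a b := Subtype.ext (star_add a.1 b.1)

instance (S : OpSystem A) : StarModule ℂ S.toSubmodule where
  star_smul c a := Subtype.ext (star_smul c a.1)

/-- The cone `M_p(S)_+`. -/
def OpSystem.matPos (S : OpSystem A) (p : ℕ) : Set (Matrix (Fin p) (Fin p) S.toSubmodule) :=
  {X | IsMatPos (X.map fun s => (s : A))}

/-- Unital completely positive maps from an operator system into a C*-algebra. -/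
structure OpSystem.IsUCP (S : OpSystem A) (φ : S.toSubmodule →ₗ[ℂ] B) : Prop where
  map_one : φ 1 = 1
  matPos : ∀ (p : ℕ) (X : Matrix (Fin p) (Fin p) S.toSubmodule), X ∈ S.matPos p →
    IsMatPos (X.map φ)

/-- `V_n = span {1, u i j, (u i j)*}` inside `U_nc(n)`. -/
def V (n : ℕ) : OpSystem (Unc n) where
  toSubmodule := Submodule.span ℂ
    ({1} ∪ (Set.range fun p : Fin n × Fin n => Unc.u p.1 p.2) ∪
      Set.range fun p : Fin n × Fin n => star (Unc.u p.1 p.2))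
  one_mem' := Submodule.subset_span (Or.inl (Or.inl rfl))
  star_mem' {a} ha := by
    change star a ∈ Submodule.span ℂ _
    refine Submodule.span_induction (p := fun a _ => star a ∈ _)
      ?_ ?_ ?_ ?_ ha
    · rintro x ((rfl | ⟨q, rfl⟩) | ⟨q, rfl⟩)
      · rw [star_one]
        exact Submodule.subset_span (Or.inl (Or.inl rfl))
      · exact Submodule.subset_span (Or.inr ⟨q, rfl⟩)
      · change star (star _) ∈ _
        rw [star_star]
        exact Submodule.subset_span (Or.inl (Or.inr ⟨q, rfl⟩))
    · rw [star_zero]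
      exact zero_mem _
    · intro x y _ _ hx hy
      rw [star_add]
      exact add_mem hx hy
    · intro c x _ hx
      rw [star_smul]
      exact Submodule.smul_mem _ _ hx

/-- The generator `u i j` as an element of `V_n`. -/
def V.u {n : ℕ} (i j : Fin n) : (V n).toSubmodule :=
  ⟨Unc.u i j, Submodule.subset_span (Or.inl (Or.inr ⟨(i, j), rfl⟩))⟩

/-! ### The commuting and the maximal tensor product -/

/-- A family of cones (of "positive elements") in the matrix spaces `M_p(W)`. -/
abbrev MatrixCones (W : Type*) : Type _ := ∀ p : ℕ, Set (Matrix (Fin p) (Fin p) W)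

/-- The product map `φ · ψ`, with `(φ · ψ)(s ⊗ t) = φ(s) ψ(t)`. -/
def prodMap {S : OpSystem A} {T : OpSystem B} {C : Type*} [CStarAlgebra C]
    (φ : S.toSubmodule →ₗ[ℂ] C) (ψ : T.toSubmodule →ₗ[ℂ] C) :
    S.toSubmodule ⊗[ℂ] T.toSubmodule →ₗ[ℂ] C :=
  TensorProduct.lift ((LinearMap.mul ℂ C).compl₁₂ φ ψ)

universe v w

/-- The matrix cones of the commuting tensor product `S ⊗_c T`: a self-adjoint `X` is positive if
and only if `(φ · ψ)(X)` is positive for all ucp maps `φ`, `ψ` of `S`, `T` into the bounded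
operators on a Hilbert space `H` with commuting ranges. -/
def commTensor {A : Type v} {B : Type w} [CStarAlgebra A] [CStarAlgebra B]
    (S : OpSystem A) (T : OpSystem B) :
    MatrixCones (S.toSubmodule ⊗[ℂ] T.toSubmodule) := fun _ =>
  {X | X.IsHermitian ∧
    ∀ (H : Type (max v w)) [NormedAddCommGroup H] [InnerProductSpace ℂ H] [CompleteSpace H]
      (φ : S.toSubmodule →ₗ[ℂ] (H →L[ℂ] H)) (ψ : T.toSubmodule →ₗ[ℂ] (H →L[ℂ] H)),
      S.IsUCP φ → T.IsUCP ψ → (∀ s t, Commute (φ s) (ψ t)) → IsMatPos (X.map (prodMap φ ψ))}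

/-- `L* Z L` for a rectangular complex matrix `L` and a matrix `Z` over a complex vector space. -/
def scalarConj {ι κ W : Type*} [Fintype ι] [AddCommGroup W] [Module ℂ W]
    (L : Matrix ι κ ℂ) (Z : Matrix ι ι W) : Matrix κ κ W :=
  Matrix.of fun i j => ∑ a, ∑ b, (star (L a i) * L b j) • Z a b

/-- The matrix cones of the maximal tensor product `S ⊗_max T`: a self-adjoint `X` is positive if
and only if for every `ε > 0` one can write `X + ε 1 = L* (P ⊗ Q) L` with `P ∈ M_k(S)_+`,
`Q ∈ M_l(T)_+` and a complex matrix `L`. -/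
def maxTensor (S : OpSystem A) (T : OpSystem B) :
    MatrixCones (S.toSubmodule ⊗[ℂ] T.toSubmodule) := fun p =>
  {X | X.IsHermitian ∧
    ∀ ε : ℝ, 0 < ε → ∃ (k l : ℕ) (P : Matrix (Fin k) (Fin k) S.toSubmodule)
      (Q : Matrix (Fin l) (Fin l) T.toSubmodule) (L : Matrix (Fin k × Fin l) (Fin p) ℂ),
      P ∈ S.matPos k ∧ Q ∈ T.matPos l ∧
        X + (ε : ℂ) • Matrix.diagonal (fun _ => (1 : S.toSubmodule) ⊗ₜ[ℂ] (1 : T.toSubmodule)) =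
          scalarConj L (Matrix.kroneckerMap (fun s t => s ⊗ₜ[ℂ] t) P Q)}

/-- `f` maps positive elements of `M_k(W)` to positive elements of `M_k(W')`. -/
def IsKPositive {W W' : Type*} [AddCommGroup W] [Module ℂ W] [AddCommGroup W'] [Module ℂ W']
    (k : ℕ) (C : MatrixCones W) (C' : MatrixCones W') (f : W →ₗ[ℂ] W') : Prop :=
  ∀ X ∈ C k, X.map f ∈ C' k

/-- States: unital positive functionals, for given matrix cones and a given unit `e`. -/
structure IsState {W : Type*} [AddCommGroup W] [Module ℂ W] (C : MatrixCones W) (e : W)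
    (s : W →ₗ[ℂ] ℂ) : Prop where
  map_unit : s e = 1
  nonneg : ∀ X ∈ C 1, 0 ≤ s (X 0 0)

/-! ### The correlation sets -/

/-- The set consisting of the identity and of all entries of `U` and their adjoints. -/
def entrySet {H : Type*} [NormedAddCommGroup H] [InnerProductSpace ℂ H] [CompleteSpace H] {n : ℕ}
    (U : Matrix (Fin n) (Fin n) (H →L[ℂ] H)) : Set (H →L[ℂ] H) :=
  {1} ∪ (Set.range fun p : Fin n × Fin n => U p.1 p.2) ∪
    Set.range fun p : Fin n × Fin n => star (U p.1 p.2)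

/-- `B_qc(n,m)`: the families `(⟨U_ij V_kl ψ, ψ⟩)`, indexed by `(i,j)` and `(k,l)`, for unitary
operator matrices `U`, `V` whose entries *-commute with each other, and unit vectors `ψ`. Mathlib's
inner product is linear in the second variable. -/
def Bqc (n m : ℕ) : Set (Matrix (Fin n × Fin n) (Fin m × Fin m) ℂ) :=
  {x | ∃ (H : Type) (_ : NormedAddCommGroup H) (_ : InnerProductSpace ℂ H) (_ : CompleteSpace H)
    (U : Matrix (Fin n) (Fin n) (H →L[ℂ] H)) (V : Matrix (Fin m) (Fin m) (H →L[ℂ] H)) (ψ : H),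
    Uᴴ * U = 1 ∧ U * Uᴴ = 1 ∧ Vᴴ * V = 1 ∧ V * Vᴴ = 1 ∧
    (∀ X ∈ entrySet U, ∀ Y ∈ entrySet V, X * Y = Y * X) ∧ ‖ψ‖ = 1 ∧
    ∀ i j k l, x (i, j) (k, l) = inner ℂ ψ ((U i j * V k l) ψ)}

/-- `B_qmax(n,m)`: the families `(s(u_ij ⊗ v_kl))`, indexed by `(i,j)` and `(k,l)`, for states `s`
on `V_n ⊗_max V_m`. -/
def Bqmax (n m : ℕ) : Set (Matrix (Fin n × Fin n) (Fin m × Fin m) ℂ) :=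
  {x | ∃ s : (V n).toSubmodule ⊗[ℂ] (V m).toSubmodule →ₗ[ℂ] ℂ,
    IsState (maxTensor (V n) (V m)) (1 ⊗ₜ[ℂ] 1) s ∧
    ∀ i j k l, x (i, j) (k, l) = s (V.u i j ⊗ₜ[ℂ] V.u k l)}

end UnitaryCorr

end

open scoped TensorProduct Matrix ComplexOrder

noncomputable section

namespace UnitaryCorr

/-! Fix two entries in one row of `u` and two entries in one column of `v`. A row of a unitary and a
column of a unitary are both contractions, so for ucp maps `φ`, `ψ` the product `t` of the two-entry
row of `φ(u)` with the two-entry column of `ψ(v)` satisfies `Re ⟨t h, h⟩ ≤ ‖h‖²`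
(`re_inner_row_mul_col_le`). Hence `2 - t - t*` is positive in the commuting tensor product
(`sepElem_mem_commTensor`), and the two corresponding correlations in `Bqc` have real parts summing
to at most 1.

The maximal tensor product admits a state violating this bound. The generators have coefficient
functionals on `V_n`, and `pairState` multiplies the coefficients of matching generators: the unit,
the two chosen pairs and their adjoints. It gives both chosen pairs the value 1, so their sum is 2
and `2 - t - t*` is sent to -2.

The crux is positivity of `pairState` (`pairMat_nonneg`). A partial isometry dilates to a unitary,
so positive matrices over `V_n` may be evaluated at partial isometries. Evaluating `Q` at a suitable
column and factoring the result as a Gram matrix expresses its coefficients as compressions of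
operators `T₀`, `T₁` forming a row partial isometry (`PairCoeff.exists_row`). Evaluating `P` at that
row and compressing gives the pairing of `P` with `Q`, which is therefore positive. -/

/-! ### Dilations and evaluation at partial isometries -/

/-- A unitary matrix over a matrix algebra gives a representation of `U_nc(n)`. -/
lemma Unc.exists_starAlgHom_matrix {n : ℕ} {N : Type} [Fintype N] [DecidableEq N]
    (a : Matrix (Fin n) (Fin n) (Matrix N N ℂ)) (h₁ : aᴴ * a = 1) (h₂ : a * aᴴ = 1) :
    ∃ π : Unc n →⋆ₐ[ℂ] Matrix N N ℂ, ∀ i j, π (Unc.u i j) = a i j := by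
  let e : Matrix N N ℂ ≃⋆ₐ[ℂ] CStarMatrix N N ℂ := CStarMatrix.ofMatrixStarAlgEquiv
  obtain ⟨π, hπ, -⟩ := Unc.universal (A := CStarMatrix N N ℂ) (a.map e)
    (by
      rw [← Matrix.conjTranspose_map e (fun x => map_star e x), ← Matrix.map_mul, h₁]
      exact Matrix.map_one _ (map_zero e) (map_one e))
    (by
      rw [← Matrix.conjTranspose_map e (fun x => map_star e x), ← Matrix.map_mul, h₂]
      exact Matrix.map_one _ (map_zero e) (map_one e))
  refine ⟨(e.symm : CStarMatrix N N ℂ →⋆ₐ[ℂ] Matrix N N ℂ).comp π, fun i j => ?_⟩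
  change e.symm (π (Unc.u i j)) = _
  rw [hπ]
  exact e.symm_apply_apply _

/-- A matrix of matrices, flattened to a matrix of scalars. -/
def flat {ι N : Type*} (X : Matrix ι ι (Matrix N N ℂ)) : Matrix (ι × N) (ι × N) ℂ :=
  Matrix.of fun x y => X x.1 y.1 x.2 y.2

lemma flat_map_posSemidef {A N : Type*} [Fintype N] [DecidableEq N] [CStarAlgebra A]
    (π : A →⋆ₐ[ℂ] Matrix N N ℂ) {p : ℕ} {X : Matrix (Fin p) (Fin p) A} (hX : IsMatPos X) :
    (flat (X.map π)).PosSemidef := by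
  obtain ⟨Y, rfl⟩ := hX
  have : flat ((Yᴴ * Y).map π) = (flat (Y.map π))ᴴ * flat (Y.map π) := by
    ext ⟨a, x⟩ ⟨b, y⟩
    simp [flat, Matrix.mul_apply, Matrix.conjTranspose_apply, Fintype.sum_prod_type, map_sum,
      Matrix.sum_apply, map_star, Matrix.star_apply]
  rw [this]
  exact Matrix.posSemidef_conjTranspose_mul_self _

/-- A partial isometry in `M_n(M_N)` dilates to a unitary, so that it is the image of the generators
of `U_nc(n)` under a unital completely positive map. -/
lemma Unc.exists_cp_of_partialIsometry {n : ℕ} {N : Type} [Fintype N] [DecidableEq N]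
    (W : Matrix (Fin n) (Fin n) (Matrix N N ℂ)) (hW : W * Wᴴ * W = W) :
    ∃ Φ : Unc n →ₗ[ℂ] Matrix N N ℂ, Φ 1 = 1 ∧ (∀ i j, Φ (Unc.u i j) = W i j) ∧
      (∀ i j, Φ (star (Unc.u i j)) = (W i j)ᴴ) ∧
      ∀ (p : ℕ) (X : Matrix (Fin p) (Fin p) (Unc n)), IsMatPos X →
        (flat (X.map Φ)).PosSemidef := by
  have hW' : Wᴴ * W * Wᴴ = Wᴴ := by
    simpa [Matrix.mul_assoc] using congrArg Matrix.conjTranspose hW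
  -- The 2 × 2 block structure is placed inside each entry, so that the dilation is again an `n × n`
  -- matrix, now over `M_{N ⊕ N}`.
  let D : Matrix (Fin n) (Fin n) (Matrix N N ℂ) → Matrix (Fin n) (Fin n) (Matrix N N ℂ) →
      Matrix (Fin n) (Fin n) (Matrix N N ℂ) → Matrix (Fin n) (Fin n) (Matrix N N ℂ) →
      Matrix (Fin n) (Fin n) (Matrix (N ⊕ N) (N ⊕ N) ℂ) := fun P Q R S =>
    Matrix.of fun i j => Matrix.fromBlocks (P i j) (Q i j) (R i j) (S i j)
  have hsum : ∀ (f g h k : Fin n → Matrix N N ℂ),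
      ∑ i, Matrix.fromBlocks (f i) (g i) (h i) (k i) =
        Matrix.fromBlocks (∑ i, f i) (∑ i, g i) (∑ i, h i) (∑ i, k i) := by
    intro f g h k
    ext (x | x) (y | y) <;> simp [Matrix.sum_apply]
  have hmul : ∀ P Q R S P' Q' R' S', D P Q R S * D P' Q' R' S' =
      D (P * P' + Q * R') (P * Q' + Q * S') (R * P' + S * R') (R * Q' + S * S') := by
    intro P Q R S P' Q' R' S'
    ext1 i j
    simp only [D, Matrix.mul_apply, Matrix.of_apply, Matrix.fromBlocks_multiply, hsum,
      Matrix.add_apply, Finset.sum_add_distrib]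
  have hstar : ∀ P Q R S, (D P Q R S)ᴴ = D Pᴴ Rᴴ Qᴴ Sᴴ := by
    intro P Q R S
    ext1 i j
    simp only [D, Matrix.conjTranspose_apply, Matrix.of_apply, Matrix.star_eq_conjTranspose,
      Matrix.fromBlocks_conjTranspose]
  have hone : D 1 0 0 1 = 1 := by
    ext1 i j
    by_cases h : i = j
    · subst h
      simp [D, Matrix.fromBlocks_one]
    · simp [D, h]
  -- The Halmos dilation. For a partial isometry the defects `1 - W Wᴴ` and `1 - Wᴴ W` are
  -- projections, so no square roots are needed.
  obtain ⟨π, hπ⟩ := Unc.exists_starAlgHom_matrix (D W (1 - W * Wᴴ) (1 - Wᴴ * W) (-Wᴴ))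
    (by
      rw [hstar, hmul, ← hone]
      congr 1 <;> simp [mul_sub, sub_mul, ← mul_assoc, hW, hW'])
    (by
      rw [hstar, hmul, ← hone]
      congr 1 <;> simp [mul_sub, sub_mul, ← mul_assoc, hW, hW'])
  let c : Matrix (N ⊕ N) (N ⊕ N) ℂ →ₗ[ℂ] Matrix N N ℂ :=
    { toFun := Matrix.toBlocks₁₁
      map_add' := fun _ _ => rfl
      map_smul' := fun _ _ => rfl }
  refine ⟨c ∘ₗ π.toLinearMap, ?_, fun i j => ?_, fun i j => ?_, fun p X hX => ?_⟩
  · change (π 1).toBlocks₁₁ = 1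
    rw [map_one, ← Matrix.fromBlocks_one, Matrix.toBlocks_fromBlocks₁₁]
  · change (π _).toBlocks₁₁ = _
    rw [hπ]
    exact Matrix.toBlocks_fromBlocks₁₁ _ _ _ _
  · change (π _).toBlocks₁₁ = _
    rw [map_star, hπ, Matrix.star_eq_conjTranspose]
    simp [D, Matrix.fromBlocks_conjTranspose]
  · exact (flat_map_posSemidef π hX).submatrix fun x : Fin p × N => (x.1, Sum.inl x.2)

/-- Linear maps on `V_n` are determined by the generators. -/
lemma V.eq_on {n : ℕ} {M : Type*} [AddCommGroup M] [Module ℂ M] {f g : Unc n →ₗ[ℂ] M}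
    (h1 : f 1 = g 1) (hu : ∀ i j, f (Unc.u i j) = g (Unc.u i j))
    (hs : ∀ i j, f (star (Unc.u i j)) = g (star (Unc.u i j))) (x : (V n).toSubmodule) :
    f x = g x := by
  refine LinearMap.eqOn_span (f := f) (g := g) ?_ x.2
  rintro _ ((rfl | ⟨q, rfl⟩) | ⟨q, rfl⟩)
  · exact h1
  · exact hu _ _
  · exact hs _ _

/-! ### Coefficient functionals on `V_n` -/

/-- The coefficient functional at the unit. -/
lemma Unc.exists_coeff_one (n : ℕ) : ∃ f : Unc n →ₗ[ℂ] ℂ, f 1 = 1 ∧ (∀ i j, f (Unc.u i j) = 0) ∧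
    ∀ i j, f (star (Unc.u i j)) = 0 := by
  -- The zero matrix is a partial isometry, and evaluating there kills every generator and its
  -- adjoint.
  obtain ⟨Φ, h1, hu, hs, -⟩ := Unc.exists_cp_of_partialIsometry (n := n) (N := Unit) 0 (by simp)
  refine ⟨Matrix.entryLinearMap ℂ ℂ () () ∘ₗ Φ, ?_, fun i j => ?_, fun i j => ?_⟩
  · simp [h1]
  · simp [hu]
  · simp [hs]

/-- The coefficient functionals at the generators and their adjoints. -/
lemma Unc.exists_coeff {n : ℕ} (r s : Fin n) : ∃ f g : Unc n →ₗ[ℂ] ℂ,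
    (f 1 = 0 ∧ (∀ i j, f (Unc.u i j) = if i = r ∧ j = s then 1 else 0) ∧
      ∀ i j, f (star (Unc.u i j)) = 0) ∧
    (g 1 = 0 ∧ (∀ i j, g (Unc.u i j) = 0) ∧
      ∀ i j, g (star (Unc.u i j)) = if i = r ∧ j = s then 1 else 0) := by
  -- The off-diagonal matrix unit separates the generator, seen in entry `(false, true)`, from its
  -- adjoint, seen in `(true, false)`; the unit contributes to neither.
  obtain ⟨Φ, h1, hu, hs, -⟩ := Unc.exists_cp_of_partialIsometry (n := n) (N := Bool)
    (Matrix.single r s (Matrix.single false true 1)) (by simp)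
  refine ⟨Matrix.entryLinearMap ℂ ℂ false true ∘ₗ Φ, Matrix.entryLinearMap ℂ ℂ true false ∘ₗ Φ,
    ⟨?_, fun i j => ?_, fun i j => ?_⟩, ?_, fun i j => ?_, fun i j => ?_⟩
  · simp [h1]
  · by_cases h : r = i ∧ s = j
    · simp [hu, h]
    · simp [hu, h, eq_comm]
  · by_cases h : r = i ∧ s = j
    · simp [hs, h]
    · simp [hs, h]
  · simp [h1]
  · by_cases h : r = i ∧ s = j
    · simp [hu, h]
    · simp [hu, h]
  · by_cases h : r = i ∧ s = j
    · simp [hs, h]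
    · simp [hs, h, eq_comm]

open scoped Kronecker

/-- Coefficient functionals on `V_n` at the unit, at two generators and at their adjoints. -/
structure PairCoeff {n : ℕ} (p q : Fin n × Fin n) where
  c : Unc n →ₗ[ℂ] ℂ
  f₀ : Unc n →ₗ[ℂ] ℂ
  f₁ : Unc n →ₗ[ℂ] ℂ
  g₀ : Unc n →ₗ[ℂ] ℂ
  g₁ : Unc n →ₗ[ℂ] ℂ
  c_one : c 1 = 1
  c_u : ∀ i j, c (Unc.u i j) = 0
  c_star : ∀ i j, c (star (Unc.u i j)) = 0
  f₀_one : f₀ 1 = 0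
  f₀_u : ∀ i j, f₀ (Unc.u i j) = if i = p.1 ∧ j = p.2 then 1 else 0
  f₀_star : ∀ i j, f₀ (star (Unc.u i j)) = 0
  f₁_one : f₁ 1 = 0
  f₁_u : ∀ i j, f₁ (Unc.u i j) = if i = q.1 ∧ j = q.2 then 1 else 0
  f₁_star : ∀ i j, f₁ (star (Unc.u i j)) = 0
  g₀_one : g₀ 1 = 0
  g₀_u : ∀ i j, g₀ (Unc.u i j) = 0
  g₀_star : ∀ i j, g₀ (star (Unc.u i j)) = if i = p.1 ∧ j = p.2 then 1 else 0
  g₁_one : g₁ 1 = 0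
  g₁_u : ∀ i j, g₁ (Unc.u i j) = 0
  g₁_star : ∀ i j, g₁ (star (Unc.u i j)) = if i = q.1 ∧ j = q.2 then 1 else 0

lemma PairCoeff.nonempty {n : ℕ} (p q : Fin n × Fin n) : Nonempty (PairCoeff p q) := by
  obtain ⟨c, hc1, hcu, hcs⟩ := Unc.exists_coeff_one n
  obtain ⟨f₀, g₀, ⟨h1, h2, h3⟩, h4, h5, h6⟩ := Unc.exists_coeff p.1 p.2
  obtain ⟨f₁, g₁, ⟨k1, k2, k3⟩, k4, k5, k6⟩ := Unc.exists_coeff q.1 q.2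
  exact ⟨⟨c, f₀, f₁, g₀, g₁, hc1, hcu, hcs, h1, h2, h3, k1, k2, k3, h4, h5, h6, k4, k5, k6⟩⟩

attribute [simp] PairCoeff.c_one PairCoeff.c_u PairCoeff.c_star PairCoeff.f₀_one PairCoeff.f₀_u
  PairCoeff.f₀_star PairCoeff.f₁_one PairCoeff.f₁_u PairCoeff.f₁_star PairCoeff.g₀_one
  PairCoeff.g₀_u PairCoeff.g₀_star PairCoeff.g₁_one PairCoeff.g₁_u PairCoeff.g₁_star

/-- The matrix over `ℂ` obtained by applying a functional to the entries of a matrix over `V_n`. -/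
def coeffMat {n k : ℕ} (P : Matrix (Fin k) (Fin k) (V n).toSubmodule) (f : Unc n →ₗ[ℂ] ℂ) :
    Matrix (Fin k) (Fin k) ℂ :=
  P.map fun x => f x

/-! ### Positivity of the pairing -/

/-- Evaluating a positive matrix over `V_n` at a partial isometry with two nonzero entries. -/
lemma PairCoeff.posSemidef_kronecker {n k : ℕ} {p q : Fin n × Fin n} (K : PairCoeff p q)
    {N : Type} [Fintype N] [DecidableEq N] (T₀ T₁ : Matrix N N ℂ)
    (hW : (Matrix.single p.1 p.2 T₀ + Matrix.single q.1 q.2 T₁) *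
      (Matrix.single p.1 p.2 T₀ + Matrix.single q.1 q.2 T₁)ᴴ *
      (Matrix.single p.1 p.2 T₀ + Matrix.single q.1 q.2 T₁) =
      Matrix.single p.1 p.2 T₀ + Matrix.single q.1 q.2 T₁)
    {P : Matrix (Fin k) (Fin k) (V n).toSubmodule} (hP : P ∈ (V n).matPos k) :
    (coeffMat P K.c ⊗ₖ (1 : Matrix N N ℂ) + coeffMat P K.f₀ ⊗ₖ T₀ + coeffMat P K.f₁ ⊗ₖ T₁ +
      coeffMat P K.g₀ ⊗ₖ T₀ᴴ + coeffMat P K.g₁ ⊗ₖ T₁ᴴ).PosSemidef := by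
  obtain ⟨Φ, h1, hu, hs, hpos⟩ := Unc.exists_cp_of_partialIsometry _ hW
  have key : ∀ x : (V n).toSubmodule, Φ x =
      K.c x • (1 : Matrix N N ℂ) + K.f₀ x • T₀ + K.f₁ x • T₁ + K.g₀ x • T₀ᴴ + K.g₁ x • T₁ᴴ := by
    intro x
    refine V.eq_on (f := Φ) (g := K.c.smulRight (1 : Matrix N N ℂ) + K.f₀.smulRight T₀ +
      K.f₁.smulRight T₁ + K.g₀.smulRight T₀ᴴ + K.g₁.smulRight T₁ᴴ) ?_ (fun i j => ?_)
      (fun i j => ?_) x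
    · simp [h1]
    · simp only [hu, Matrix.add_apply, Matrix.single_apply, LinearMap.add_apply,
        LinearMap.smulRight_apply, K.c_u, K.f₀_u, K.f₁_u, K.g₀_u, K.g₁_u, ite_smul, one_smul,
        zero_smul, zero_add, add_zero, @eq_comm _ i, @eq_comm _ j]
    · simp only [hs, Matrix.add_apply, Matrix.single_apply, LinearMap.add_apply,
        LinearMap.smulRight_apply, K.c_star, K.f₀_star, K.f₁_star, K.g₀_star, K.g₁_star, ite_smul,
        one_smul, zero_smul, zero_add, add_zero, @eq_comm _ i, @eq_comm _ j,
        Matrix.conjTranspose_add, apply_ite Matrix.conjTranspose, Matrix.conjTranspose_zero]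
  convert hpos k _ hP using 1
  ext ⟨a, x⟩ ⟨b, y⟩
  simp [flat, key, coeffMat]

lemma PairCoeff.posSemidef_coeffMat_c {n k : ℕ} {p q : Fin n × Fin n} (K : PairCoeff p q)
    {P : Matrix (Fin k) (Fin k) (V n).toSubmodule} (hP : P ∈ (V n).matPos k) :
    (coeffMat P K.c).PosSemidef := by
  have := (K.posSemidef_kronecker (N := Unit) 0 0 (by simp) hP).submatrix fun i => (i, ())
  convert this using 1
  ext i j
  simp

/-- A positive matrix over `V_m` with positive definite unit coefficient yields a pair of partial
isometries with orthogonal ranges and equal initial projections. -/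
lemma PairCoeff.exists_row {m l : ℕ} {k₀ k₁ c : Fin m} (hk : k₀ ≠ k₁)
    (K : PairCoeff (k₀, c) (k₁, c))
    {Q : Matrix (Fin l) (Fin l) (V m).toSubmodule} (hQ : Q ∈ (V m).matPos l)
    (hdef : (coeffMat Q K.c).PosDef) :
    ∃ (T₀ T₁ : Matrix (Fin l × Fin 3) (Fin l × Fin 3) ℂ) (E : Matrix (Fin l × Fin 3) (Fin l) ℂ),
      T₀ * T₀ᴴ * T₀ = T₀ ∧ T₁ * T₁ᴴ * T₁ = T₁ ∧ T₀ᴴ * T₁ = 0 ∧ T₁ᴴ * T₀ = 0 ∧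
      Eᴴ * E = coeffMat Q K.c ∧ Eᴴ * T₀ * E = coeffMat Q K.f₀ ∧ Eᴴ * T₁ * E = coeffMat Q K.f₁ ∧
      Eᴴ * T₀ᴴ * E = coeffMat Q K.g₀ ∧ Eᴴ * T₁ᴴ * E = coeffMat Q K.g₁ := by
  -- The two matrix units have orthogonal initial projections, so the column they form is a partial
  -- isometry. The result is a 3 × 3 block matrix with the unit coefficient on the diagonal, the
  -- coefficients of the two generators in blocks `(2,0)` and `(2,1)`, and zero in block `(0,1)`.
  have hpos := K.posSemidef_kronecker (Matrix.single (2 : Fin 3) 0 1) (Matrix.single (2 : Fin 3) 1 1)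
    (by simp [add_mul, mul_add, Matrix.conjTranspose_single, hk, hk.symm]) hQ
  obtain ⟨F, hF⟩ : ∃ F : Matrix (Fin l × Fin 3) (Fin l × Fin 3) ℂ, _ = Fᴴ * F := by
    open scoped MatrixOrder Matrix.Norms.L2Operator in
    exact CStarAlgebra.nonneg_iff_eq_star_mul_self.mp hpos.nonneg
  -- The block columns of `F`, whose Gram blocks `(B s)ᴴ * B t` are the blocks of the evaluated
  -- matrix.
  let B : Fin 3 → Matrix (Fin l × Fin 3) (Fin l) ℂ := fun t => F.submatrix id fun a => (a, t)
  have hB : ∀ s t, (B s)ᴴ * B t = (Fᴴ * F).submatrix (fun a => (a, s)) fun a => (a, t) :=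
    fun s t => by ext; simp [B, Matrix.mul_apply]
  have h00 : (B 0)ᴴ * B 0 = coeffMat Q K.c := by rw [hB, ← hF]; ext; simp
  have h11 : (B 1)ᴴ * B 1 = coeffMat Q K.c := by rw [hB, ← hF]; ext; simp
  have h22 : (B 2)ᴴ * B 2 = coeffMat Q K.c := by rw [hB, ← hF]; ext; simp
  have h01 : (B 0)ᴴ * B 1 = 0 := by rw [hB, ← hF]; ext; simp
  have h10 : (B 1)ᴴ * B 0 = 0 := by rw [hB, ← hF]; ext; simp
  have h20 : (B 2)ᴴ * B 0 = coeffMat Q K.f₀ := by rw [hB, ← hF]; ext; simp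
  have h21 : (B 2)ᴴ * B 1 = coeffMat Q K.f₁ := by rw [hB, ← hF]; ext; simp
  have h02 : (B 0)ᴴ * B 2 = coeffMat Q K.g₀ := by rw [hB, ← hF]; ext; simp
  have h12 : (B 1)ᴴ * B 2 = coeffMat Q K.g₁ := by rw [hB, ← hF]; ext; simp
  set A := coeffMat Q K.c
  have hAu : IsUnit A.det := (Matrix.isUnit_iff_isUnit_det _).mp hdef.isUnit
  have hAs : (A⁻¹)ᴴ = A⁻¹ := hdef.inv.isHermitian
  have a1 : A * A⁻¹ = 1 := Matrix.mul_nonsing_inv _ hAu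
  have a2 : A⁻¹ * A = 1 := Matrix.nonsing_inv_mul _ hAu
  -- `T_s = B s * A⁻¹ * (B 2)ᴴ` sends `B 2 x` to `B s x`. It is a partial isometry because `B s` and
  -- `B 2` have the same Gram matrix `A`; the ranges are orthogonal because `(B 0)ᴴ * B 1 = 0`.
  -- Compressing by `E = B 2` recovers the coefficients of `Q`.
  have hT : ∀ s, (B s * A⁻¹ * (B 2)ᴴ)ᴴ = B 2 * A⁻¹ * (B s)ᴴ := fun s => by
    simp [Matrix.conjTranspose_mul, hAs, Matrix.mul_assoc]
  have hTT : ∀ s t, (B s * A⁻¹ * (B 2)ᴴ)ᴴ * (B t * A⁻¹ * (B 2)ᴴ) =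
      B 2 * A⁻¹ * ((B s)ᴴ * B t) * A⁻¹ * (B 2)ᴴ := fun s t => by
    rw [hT]; simp only [Matrix.mul_assoc]
  have hTTT : ∀ s, (B s)ᴴ * B s = A → (B s * A⁻¹ * (B 2)ᴴ) * (B s * A⁻¹ * (B 2)ᴴ)ᴴ *
      (B s * A⁻¹ * (B 2)ᴴ) = B s * A⁻¹ * (B 2)ᴴ := fun s h => by
    calc _ = B s * A⁻¹ * ((B 2)ᴴ * B 2) * A⁻¹ * ((B s)ᴴ * B s) * A⁻¹ * (B 2)ᴴ := by
          rw [hT]; simp only [Matrix.mul_assoc]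
      _ = B s * (A⁻¹ * A) * (A⁻¹ * A) * A⁻¹ * (B 2)ᴴ := by
          rw [h22, h]; simp only [Matrix.mul_assoc]
      _ = _ := by rw [a2]; simp
  have hE : ∀ s, (B 2)ᴴ * (B s * A⁻¹ * (B 2)ᴴ) * B 2 = (B 2)ᴴ * B s := fun s => by
    calc _ = (B 2)ᴴ * B s * (A⁻¹ * ((B 2)ᴴ * B 2)) := by simp only [Matrix.mul_assoc]
      _ = _ := by rw [h22, a2, Matrix.mul_one]
  have hE' : ∀ s, (B 2)ᴴ * (B s * A⁻¹ * (B 2)ᴴ)ᴴ * B 2 = (B s)ᴴ * B 2 := fun s => by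
    calc _ = ((B 2)ᴴ * B 2) * A⁻¹ * ((B s)ᴴ * B 2) := by
          rw [hT]; simp only [Matrix.mul_assoc]
      _ = _ := by rw [h22, a1, Matrix.one_mul]
  refine ⟨B 0 * A⁻¹ * (B 2)ᴴ, B 1 * A⁻¹ * (B 2)ᴴ, B 2, hTTT 0 h00, hTTT 1 h11, ?_, ?_, h22,
    (hE 0).trans h20, (hE 1).trans h21, (hE' 0).trans h02, (hE' 1).trans h12⟩
  · rw [hTT, h01]; simp
  · rw [hTT, h10]; simp

/-- The Gram matrix of the pairing of a positive matrix over `V_n` with one over `V_m`. -/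
def pairMat {n m k l : ℕ} {p q : Fin n × Fin n} {p' q' : Fin m × Fin m} (K : PairCoeff p q)
    (K' : PairCoeff p' q') (P : Matrix (Fin k) (Fin k) (V n).toSubmodule)
    (Q : Matrix (Fin l) (Fin l) (V m).toSubmodule) : Matrix (Fin k × Fin l) (Fin k × Fin l) ℂ :=
  coeffMat P K.c ⊗ₖ coeffMat Q K'.c + coeffMat P K.f₀ ⊗ₖ coeffMat Q K'.f₀ +
    coeffMat P K.f₁ ⊗ₖ coeffMat Q K'.f₁ + coeffMat P K.g₀ ⊗ₖ coeffMat Q K'.g₀ +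
    coeffMat P K.g₁ ⊗ₖ coeffMat Q K'.g₁

/-- Since `T₀` and `T₁` have orthogonal ranges, the row `(T₀, T₁)` is a partial isometry at which
`P` can be evaluated. Conjugation by `1 ⊗ E` then turns each `T_s` into a coefficient matrix of `Q`.
-/
lemma pairMat_posSemidef_of_posDef {n m k l : ℕ} {r j₀ j₁ : Fin n} {k₀ k₁ c : Fin m} (hj : j₀ ≠ j₁)
    (hk : k₀ ≠ k₁) (K : PairCoeff (r, j₀) (r, j₁)) (K' : PairCoeff (k₀, c) (k₁, c))
    {P : Matrix (Fin k) (Fin k) (V n).toSubmodule} (hP : P ∈ (V n).matPos k)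
    {Q : Matrix (Fin l) (Fin l) (V m).toSubmodule} (hQ : Q ∈ (V m).matPos l)
    (hdef : (coeffMat Q K'.c).PosDef) : (pairMat K K' P Q).PosSemidef := by
  obtain ⟨T₀, T₁, E, t0, t1, t01, t10, e, e0, e1, e0', e1'⟩ := K'.exists_row hk hQ hdef
  have := (K.posSemidef_kronecker T₀ T₁
    (by simp [add_mul, mul_add, Matrix.conjTranspose_single, Matrix.star_eq_conjTranspose, hj,
          hj.symm, t0, t1, mul_assoc T₁ T₁ᴴ T₀, mul_assoc T₀ T₀ᴴ T₁, t01, t10])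
    hP).conjTranspose_mul_mul_same ((1 : Matrix (Fin k) (Fin k) ℂ) ⊗ₖ E)
  convert this using 1
  simp only [Matrix.conjTranspose_kronecker, Matrix.conjTranspose_one, Matrix.mul_add,
    Matrix.add_mul, ← Matrix.mul_kronecker_mul, Matrix.one_mul, Matrix.mul_one, e, e0, e1, e0', e1',
    pairMat]

lemma exists_star_mul_self_eq_add {A : Type*} [CStarAlgebra A] (x y : A) :
    ∃ z, star x * x + star y * y = star z * z := by
  let _ : PartialOrder A := CStarAlgebra.spectralOrder A
  have : StarOrderedRing A := CStarAlgebra.spectralOrderedRing A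
  exact CStarAlgebra.nonneg_iff_eq_star_mul_self.mp
    (add_nonneg (star_mul_self_nonneg x) (star_mul_self_nonneg y))

/-- `M_p(A)` is itself a C*-algebra, so a sum of two elements of the form `Y* Y` has that form
again. -/
lemma IsMatPos.add {A : Type*} [CStarAlgebra A] {p : ℕ} {X Y : Matrix (Fin p) (Fin p) A}
    (hX : IsMatPos X) (hY : IsMatPos Y) : IsMatPos (X + Y) := by
  let _ : PartialOrder A := CStarAlgebra.spectralOrder A
  have : StarOrderedRing A := CStarAlgebra.spectralOrderedRing A
  obtain ⟨x, rfl⟩ := hX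
  obtain ⟨y, rfl⟩ := hY
  exact exists_star_mul_self_eq_add (A := CStarMatrix (Fin p) (Fin p) A) x y

lemma nonneg_of_forall_add_mul {f g : ℂ} (h : ∀ ε : ℝ, 0 < ε → 0 ≤ f + ε * g) : 0 ≤ f := by
  have hc : Continuous fun ε : ℝ => f + ε * g := by fun_prop
  have ht : Filter.Tendsto (fun ε : ℝ => f + ε * g) (nhdsWithin 0 (Set.Ioi 0)) (nhds f) := by
    simpa using (hc.tendsto 0).mono_left nhdsWithin_le_nhds
  exact ge_of_tendsto ht (Filter.eventually_of_mem self_mem_nhdsWithin h)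

/-- Removes the definiteness assumption on the unit coefficient of `Q` by perturbing `Q` to `Q + ε`
and letting `ε → 0`. -/
lemma pairMat_nonneg {n m k l : ℕ} {r j₀ j₁ : Fin n} {k₀ k₁ c : Fin m} (hj : j₀ ≠ j₁)
    (hk : k₀ ≠ k₁) (K : PairCoeff (r, j₀) (r, j₁)) (K' : PairCoeff (k₀, c) (k₁, c))
    {P : Matrix (Fin k) (Fin k) (V n).toSubmodule} (hP : P ∈ (V n).matPos k)
    {Q : Matrix (Fin l) (Fin l) (V m).toSubmodule} (hQ : Q ∈ (V m).matPos l)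
    (x : Fin k × Fin l → ℂ) : 0 ≤ star x ⬝ᵥ (pairMat K K' P Q *ᵥ x) := by
  refine nonneg_of_forall_add_mul (g := star x ⬝ᵥ ((coeffMat P K.c ⊗ₖ 1) *ᵥ x)) fun ε hε => ?_
  let Q' : Matrix (Fin l) (Fin l) (V m).toSubmodule := Q + Matrix.diagonal fun _ => (ε : ℂ) • 1
  have hQ' : Q' ∈ (V m).matPos l := by
    have h : IsMatPos (Matrix.diagonal fun _ : Fin l => (ε : ℂ) • (1 : Unc m)) := by
      refine ⟨Matrix.diagonal fun _ => ((√ε : ℝ) : ℂ) • 1, ?_⟩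
      simp only [Matrix.diagonal_conjTranspose, Matrix.diagonal_mul_diagonal]
      congr 1
      ext1
      simp [smul_smul, Real.mul_self_sqrt hε.le]
    have := IsMatPos.add hQ h
    change IsMatPos _
    convert this using 1
    ext i j
    by_cases hij : i = j
    · subst hij
      simp [Q']
      rfl
    · simp [Q', hij]
  have hco : ∀ f : Unc m →ₗ[ℂ] ℂ, coeffMat Q' f = coeffMat Q f + ((ε : ℂ) * f 1) • 1 := by
    intro f
    ext i j
    by_cases hij : i = j
    · subst hij
      simp [Q', coeffMat]
      exact Or.inl rfl
    · simp [Q', coeffMat, hij]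
  have hdef : (coeffMat Q' K'.c).PosDef := by
    rw [hco, K'.c_one, mul_one, add_comm]
    exact (Matrix.PosDef.one.smul (by exact_mod_cast hε)).add_posSemidef
      (K'.posSemidef_coeffMat_c hQ)
  have := (pairMat_posSemidef_of_posDef hj hk K K' hP hQ' hdef).dotProduct_mulVec_nonneg x
  convert this using 1
  -- Only the functional `c` sees the unit, so the perturbation affects only the first summand of
  -- the pairing.
  have : pairMat K K' P Q' = pairMat K K' P Q + (ε : ℂ) • (coeffMat P K.c ⊗ₖ 1) := by
    simp only [pairMat, hco, K'.c_one, K'.f₀_one, K'.f₁_one, K'.g₀_one, K'.g₁_one, mul_zero,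
      zero_smul, add_zero, mul_one, Matrix.kronecker_add, Matrix.kronecker_smul]
    abel
  rw [this, Matrix.add_mulVec, dotProduct_add, Matrix.smul_mulVec, dotProduct_smul, smul_eq_mul]

/-! ### The state on the maximal tensor product -/

/-- The restriction of a functional on `U_nc(n)` to `V_n`. -/
def restr {n : ℕ} {M : Type*} [AddCommGroup M] [Module ℂ M] (f : Unc n →ₗ[ℂ] M) :
    (V n).toSubmodule →ₗ[ℂ] M :=
  f ∘ₗ (V n).toSubmodule.subtype

/-- The functional on `V_n ⊗ V_m` pairing the coefficients. -/
def pairState {n m : ℕ} {p q : Fin n × Fin n} {p' q' : Fin m × Fin m} (K : PairCoeff p q)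
    (K' : PairCoeff p' q') : (V n).toSubmodule ⊗[ℂ] (V m).toSubmodule →ₗ[ℂ] ℂ :=
  prodMap (restr K.c) (restr K'.c) + prodMap (restr K.f₀) (restr K'.f₀) +
    prodMap (restr K.f₁) (restr K'.f₁) + prodMap (restr K.g₀) (restr K'.g₀) +
    prodMap (restr K.g₁) (restr K'.g₁)

lemma pairState_tmul {n m : ℕ} {p q : Fin n × Fin n} {p' q' : Fin m × Fin m} (K : PairCoeff p q)
    (K' : PairCoeff p' q') (x : (V n).toSubmodule) (y : (V m).toSubmodule) :
    pairState K K' (x ⊗ₜ y) = K.c x * K'.c y + K.f₀ x * K'.f₀ y + K.f₁ x * K'.f₁ y +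
      K.g₀ x * K'.g₀ y + K.g₁ x * K'.g₁ y := rfl

lemma isState_pairState {n m : ℕ} {r j₀ j₁ : Fin n} {k₀ k₁ c : Fin m} (hj : j₀ ≠ j₁)
    (hk : k₀ ≠ k₁) (K : PairCoeff (r, j₀) (r, j₁)) (K' : PairCoeff (k₀, c) (k₁, c)) :
    IsState (maxTensor (V n) (V m)) (1 ⊗ₜ[ℂ] 1) (pairState K K') := by
  have hunit : pairState K K' (1 ⊗ₜ[ℂ] 1) = 1 := by
    rw [pairState_tmul]
    change K.c 1 * K'.c 1 + K.f₀ 1 * K'.f₀ 1 + K.f₁ 1 * K'.f₁ 1 + K.g₀ 1 * K'.g₀ 1 +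
      K.g₁ 1 * K'.g₁ 1 = 1
    simp
  refine ⟨hunit, fun X hX => nonneg_of_forall_add_mul (g := 1) fun ε hε => ?_⟩
  obtain ⟨k, l, P, Q, L, hP, hQ, h⟩ := hX.2 ε hε
  have h0 := congrArg (pairState K K') (congrFun (congrFun h 0) 0)
  simp only [Matrix.add_apply, Matrix.smul_apply, Matrix.diagonal_apply_eq, map_add, map_smul,
    hunit, smul_eq_mul] at h0
  rw [h0]
  -- For a 1 × 1 matrix, `L* (P ⊗ Q) L` is mapped to the quadratic form of `pairMat` at the single
  -- column of `L`.
  convert pairMat_nonneg hj hk K K' hP hQ (fun a => L a 0) using 1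
  simp only [scalarConj, Matrix.of_apply, map_sum, map_smul, smul_eq_mul, dotProduct,
    Matrix.mulVec, Finset.mul_sum, Pi.star_apply, Matrix.kroneckerMap_apply, pairState_tmul]
  refine Finset.sum_congr rfl fun a _ => Finset.sum_congr rfl fun b _ => ?_
  simp only [pairMat, coeffMat, Matrix.add_apply, Matrix.kroneckerMap_apply, Matrix.map_apply]
  ring

/-- The values of the functional on products of generators. -/
lemma pairState_u {n m : ℕ} {p q : Fin n × Fin n} {p' q' : Fin m × Fin m} (K : PairCoeff p q)
    (K' : PairCoeff p' q') (i j : Fin n) (k l : Fin m) :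
    pairState K K' (V.u i j ⊗ₜ V.u k l) =
      (if i = p.1 ∧ j = p.2 then 1 else 0) * (if k = p'.1 ∧ l = p'.2 then 1 else 0) +
      (if i = q.1 ∧ j = q.2 then 1 else 0) * (if k = q'.1 ∧ l = q'.2 then 1 else 0) := by
  rw [pairState_tmul]
  simp only [V.u, K.c_u, K.f₀_u, K.f₁_u, K.g₀_u, K.g₁_u, K'.f₀_u, K'.f₁_u, zero_mul, zero_add,
    add_zero]

lemma pairState_star_u {n m : ℕ} {p q : Fin n × Fin n} {p' q' : Fin m × Fin m} (K : PairCoeff p q)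
    (K' : PairCoeff p' q') (i j : Fin n) (k l : Fin m) :
    pairState K K' (star (V.u i j) ⊗ₜ star (V.u k l)) =
      (if i = p.1 ∧ j = p.2 then 1 else 0) * (if k = p'.1 ∧ l = p'.2 then 1 else 0) +
      (if i = q.1 ∧ j = q.2 then 1 else 0) * (if k = q'.1 ∧ l = q'.2 then 1 else 0) := by
  rw [pairState_tmul]
  change K.c (star (Unc.u i j)) * K'.c (star (Unc.u k l)) +
    K.f₀ (star (Unc.u i j)) * K'.f₀ (star (Unc.u k l)) +
    K.f₁ (star (Unc.u i j)) * K'.f₁ (star (Unc.u k l)) +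
    K.g₀ (star (Unc.u i j)) * K'.g₀ (star (Unc.u k l)) +
    K.g₁ (star (Unc.u i j)) * K'.g₁ (star (Unc.u k l)) = _
  simp only [K.c_star, K.f₀_star, K.f₁_star, K.g₀_star, K.g₁_star, K'.g₀_star, K'.g₁_star, zero_mul,
    zero_add]

/-! ### Row and column contractions under ucp maps -/

section Operators

variable {H : Type*} [NormedAddCommGroup H] [InnerProductSpace ℂ H] [CompleteSpace H]

lemma IsMatPos.re_inner_nonneg {p : ℕ} {X : Matrix (Fin p) (Fin p) (H →L[ℂ] H)} (hX : IsMatPos X)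
    (h : Fin p → H) : 0 ≤ (∑ a, ∑ b, inner ℂ (h a) (X a b (h b))).re := by
  obtain ⟨Y, rfl⟩ := hX
  have : ∑ a, ∑ b, inner ℂ (h a) ((Yᴴ * Y) a b (h b)) =
      ∑ c, inner ℂ (∑ a, Y c a (h a)) (∑ b, Y c b (h b)) := by
    simp_rw [sum_inner, inner_sum]
    rw [Finset.sum_comm (s := Finset.univ (α := Fin p))]
    simp only [Matrix.mul_apply, Matrix.conjTranspose_apply, sum_apply, inner_sum,
      mul_apply_eq_comp, ContinuousLinearMap.star_eq_adjoint,
      ContinuousLinearMap.adjoint_inner_right]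
    rw [Finset.sum_comm, Finset.sum_comm (s := Finset.univ (α := Fin p))]
    refine (Finset.sum_congr rfl fun a _ => Finset.sum_comm).trans ?_
    rw [Finset.sum_comm]
    exact Finset.sum_congr rfl fun _ _ => Finset.sum_comm
  rw [this, Complex.re_sum]
  exact Finset.sum_nonneg fun c _ => inner_self_nonneg (𝕜 := ℂ)

/-- If `x x* = 1`, the block matrix `[[1, x], [x*, I]]` is positive, and `φ` preserves this.
Self-adjointness of the image gives compatibility with the involution; its quadratic form gives the
inequality. -/
lemma OpSystem.IsUCP.contractive_row {A : Type*} [CStarAlgebra A] {S : OpSystem A}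
    {φ : S.toSubmodule →ₗ[ℂ] (H →L[ℂ] H)} (hφ : S.IsUCP φ) {n : ℕ} (x : Fin n → S.toSubmodule)
    (hx : ∑ j, (x j : A) * star (x j : A) = 1) :
    (∀ j, φ (star (x j)) = star (φ (x j))) ∧
      ∀ (g : H) (h : Fin n → H),
        0 ≤ ‖g‖ ^ 2 + 2 * ∑ j, (inner ℂ g (φ (x j) (h j))).re + ∑ j, ‖h j‖ ^ 2 := by
  let R : Matrix (Fin (n + 1)) (Fin (n + 1)) S.toSubmodule :=
    Matrix.of (Fin.cons (Fin.cons 1 x) fun i => Fin.cons (star (x i)) fun j => if i = j then 1 else 0)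
  have hR : R ∈ S.matPos (n + 1) := by
    -- The natural factor `[x*, I]` has one row too few, and a zero row makes it square.
    refine ⟨Matrix.of (Fin.cons 0 fun i => Fin.cons (star (x i : A)) fun j =>
      if i = j then 1 else 0), ?_⟩
    ext i j
    refine Fin.cases ?_ (fun i => ?_) i <;> refine Fin.cases ?_ (fun j => ?_) j
    · simp [R, Matrix.mul_apply, Fin.sum_univ_succ, hx]
      rfl
    · simp [R, Matrix.mul_apply, Fin.sum_univ_succ]
    · simp [R, Matrix.mul_apply, Fin.sum_univ_succ, apply_ite star]
      rfl
    · simp [R, Matrix.mul_apply, Fin.sum_univ_succ, apply_ite star]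
      by_cases hij : i = j
      · subst hij
        simp
        rfl
      · simp [hij, Ne.symm hij]
  have hpos := hφ.matPos _ R hR
  have hstar : ∀ j, φ (star (x j)) = star (φ (x j)) := fun j => by
    have : (R.map φ)ᴴ = R.map φ := by
      obtain ⟨Y, hY⟩ := hpos
      simp [hY]
    exact (congrFun (congrFun this j.succ) 0).symm
  refine ⟨hstar, fun g h => ?_⟩
  have := hpos.re_inner_nonneg (Fin.cons g h)
  have h1 : ∀ i j : Fin n, inner ℂ (h i) (φ (if i = j then 1 else 0) (h j)) =
      if i = j then ((‖h i‖ ^ 2 : ℝ) : ℂ) else 0 := by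
    intro i j
    by_cases hij : i = j
    · subst hij
      simp [hφ.map_one]
    · simp [hij]
  have h2 : ∀ j, (inner ℂ (h j) ((star (φ (x j))) g)).re = (inner ℂ g (φ (x j) (h j))).re := by
    intro j
    rw [ContinuousLinearMap.star_eq_adjoint, ContinuousLinearMap.adjoint_inner_right,
      ← inner_conj_symm, Complex.conj_re]
  simp only [Fin.sum_univ_succ, Fin.cons_zero, Fin.cons_succ, R, Matrix.map_apply, Matrix.of_apply,
    hφ.map_one, hstar, h1, Finset.sum_ite_eq, Finset.mem_univ, if_true, Complex.add_re,
    Complex.re_sum, h2, Complex.ofReal_re, one_apply_eq_self, inner_self_eq_norm_sq_to_K,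
    Finset.sum_add_distrib] at this
  have h3 : (((‖g‖ : ℝ) : ℂ) ^ 2).re = ‖g‖ ^ 2 := by
    rw [← Complex.ofReal_pow, Complex.ofReal_re]
  simp only [Complex.coe_algebraMap, h3] at this
  linarith

lemma OpSystem.IsUCP.contractive_pair {A : Type*} [CStarAlgebra A] {S : OpSystem A}
    {φ : S.toSubmodule →ₗ[ℂ] (H →L[ℂ] H)} (hφ : S.IsUCP φ) {n : ℕ} (x : Fin n → S.toSubmodule)
    (hx : ∑ j, (x j : A) * star (x j : A) = 1) {j₀ j₁ : Fin n} (hj : j₀ ≠ j₁) (g h₀ h₁ : H) :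
    0 ≤ ‖g‖ ^ 2 + 2 * ((inner ℂ g (φ (x j₀) h₀)).re + (inner ℂ g (φ (x j₁) h₁)).re) +
      (‖h₀‖ ^ 2 + ‖h₁‖ ^ 2) := by
  -- Zero vectors in the remaining slots reduce the row to its two chosen entries.
  have := (hφ.contractive_row x hx).2 g fun j => if j = j₀ then h₀ else if j = j₁ then h₁ else 0
  rw [Fintype.sum_eq_add j₀ j₁ hj (by rintro j ⟨h, h'⟩; simp [h, h']),
    Fintype.sum_eq_add j₀ j₁ hj (by rintro j ⟨h, h'⟩; simp [h, h'])] at this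
  simpa [hj.symm] using this

end Operators

lemma Unc.sum_row {n : ℕ} (r : Fin n) : ∑ j, Unc.u r j * star (Unc.u r j) = 1 := by
  simpa [Matrix.mul_apply] using congrFun (congrFun (Unc.u_unitary n).2 r) r

lemma Unc.sum_col {n : ℕ} (c : Fin n) : ∑ k, star (Unc.u k c) * Unc.u k c = 1 := by
  simpa [Matrix.mul_apply] using congrFun (congrFun (Unc.u_unitary n).1 c) c

section Comm

variable {H : Type*} [NormedAddCommGroup H] [InnerProductSpace ℂ H] [CompleteSpace H]
  {n m : ℕ} {φ : (V n).toSubmodule →ₗ[ℂ] (H →L[ℂ] H)} {ψ : (V m).toSubmodule →ₗ[ℂ] (H →L[ℂ] H)}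

lemma V.map_star_u (hφ : (V n).IsUCP φ) (i j : Fin n) : φ (star (V.u i j)) = star (φ (V.u i j)) :=
  (hφ.contractive_row (fun j => V.u i j) (Unc.sum_row i)).1 j

/-- The row of `φ` times the column of `ψ` is a contraction. -/
lemma re_inner_row_mul_col_le (hφ : (V n).IsUCP φ) (hψ : (V m).IsUCP ψ) (r : Fin n) {j₀ j₁ : Fin n}
    (hj : j₀ ≠ j₁) {k₀ k₁ : Fin m} (hk : k₀ ≠ k₁) (c : Fin m) (h : H) :
    (inner ℂ h ((φ (V.u r j₀) * ψ (V.u k₀ c)) h)).re +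
      (inner ℂ h ((φ (V.u r j₁) * ψ (V.u k₁ c)) h)).re ≤ ‖h‖ ^ 2 := by
  -- The adjoints of a column of `v` form a row. With this choice of vectors the inequality says
  -- that `‖ψ(v_{k₀c}) h‖² + ‖ψ(v_{k₁c}) h‖² ≤ ‖h‖²`; adding it to `hrow` cancels these norms.
  have hcol := hψ.contractive_pair (fun k => star (V.u k c))
    ((Finset.sum_congr rfl fun k _ => by
      change star (Unc.u k c) * star (star (Unc.u k c)) = _
      rw [star_star]).trans (Unc.sum_col c)) hk h (-(ψ (V.u k₀ c) h)) (-(ψ (V.u k₁ c) h))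
  have hrow := hφ.contractive_pair (fun j => V.u r j) (Unc.sum_row r) hj h
    (-(ψ (V.u k₀ c) h)) (-(ψ (V.u k₁ c) h))
  have hin : ∀ k, (inner ℂ h (ψ (star (V.u k c)) (-(ψ (V.u k c) h)))).re =
      -‖ψ (V.u k c) h‖ ^ 2 := by
    intro k
    rw [V.map_star_u hψ, ContinuousLinearMap.star_eq_adjoint,
      ContinuousLinearMap.adjoint_inner_right, inner_neg_right, Complex.neg_re,
      inner_self_eq_norm_sq_to_K]
    simp [← Complex.ofReal_pow]
  simp only [hin, norm_neg] at hcol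
  simp only [map_neg, inner_neg_right, Complex.neg_re, norm_neg] at hrow
  simp only [mul_apply_eq_comp]
  linarith

end Comm

/-! ### The separating element and the conclusion -/

/-- The element of `V_n ⊗ V_m` separating the two tensor products. -/
def sepElem {n m : ℕ} (r j₀ j₁ : Fin n) (k₀ k₁ c : Fin m) :
    (V n).toSubmodule ⊗[ℂ] (V m).toSubmodule :=
  (2 : ℂ) • (1 ⊗ₜ 1) - (V.u r j₀ ⊗ₜ V.u k₀ c + V.u r j₁ ⊗ₜ V.u k₁ c) -
    (star (V.u r j₀) ⊗ₜ star (V.u k₀ c) + star (V.u r j₁) ⊗ₜ star (V.u k₁ c))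

lemma prodMap_tmul {A B C : Type*} [CStarAlgebra A] [CStarAlgebra B] [CStarAlgebra C]
    {S : OpSystem A} {T : OpSystem B} (φ : S.toSubmodule →ₗ[ℂ] C) (ψ : T.toSubmodule →ₗ[ℂ] C)
    (s : S.toSubmodule) (t : T.toSubmodule) : prodMap φ ψ (s ⊗ₜ t) = φ s * ψ t := rfl

/-- Commuting ranges make the image of the adjoint terms equal to `star t`, so the image of the
element is `2 - t - t*`, whose positivity is exactly the row-times-column bound. -/
lemma sepElem_mem_commTensor {n m : ℕ} (r : Fin n) {j₀ j₁ : Fin n} (hj : j₀ ≠ j₁) {k₀ k₁ : Fin m}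
    (hk : k₀ ≠ k₁) (c : Fin m) :
    (Matrix.of fun _ _ => sepElem r j₀ j₁ k₀ k₁ c) ∈ commTensor (V n) (V m) 1 := by
  refine ⟨?_, fun H _ _ _ φ ψ hφ hψ hc => ?_⟩
  · have h2 : star (2 : ℂ) = 2 := by simp
    have h1 : star (1 : (V n).toSubmodule) = 1 := Subtype.ext (star_one _)
    have h1' : star (1 : (V m).toSubmodule) = 1 := Subtype.ext (star_one _)
    ext i j
    simp only [Matrix.conjTranspose_apply, Matrix.of_apply, sepElem, star_sub, star_add, star_smul,
      TensorProduct.star_tmul, star_star, h2, h1, h1']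
    abel
  · set t := φ (V.u r j₀) * ψ (V.u k₀ c) + φ (V.u r j₁) * ψ (V.u k₁ c) with ht
    have hcs : ∀ x y, star (φ x) * star (ψ y) = star (ψ y) * star (φ x) := fun x y => by
      rw [← star_mul, ← star_mul, (hc x y).eq]
    have hD : prodMap φ ψ (sepElem r j₀ j₁ k₀ k₁ c) = (2 : ℂ) • 1 - t - star t := by
      simp only [sepElem, map_sub, map_add, map_smul, prodMap_tmul, hφ.map_one, hψ.map_one, mul_one,
        V.map_star_u hφ, V.map_star_u hψ, ht, star_add, star_mul]
      simp only [hcs]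
    have hpos : 0 ≤ (2 : ℂ) • (1 : H →L[ℂ] H) - t - star t := by
      rw [ContinuousLinearMap.nonneg_iff_isPositive, ContinuousLinearMap.isPositive_def']
      refine ⟨?_, fun h => ?_⟩
      · simp [IsSelfAdjoint, star_smul]
        abel
      · have := re_inner_row_mul_col_le hφ hψ r hj hk c h
        have h1 : (inner ℂ (t h) h).re = (inner ℂ h (t h)).re := inner_re_symm (𝕜 := ℂ) _ _
        rw [← Complex.add_re, ← inner_add_right, ← add_apply, ← ht] at this
        rw [ContinuousLinearMap.reApplyInnerSelf_apply]
        simp only [sub_apply, smul_apply, one_apply_eq_self, inner_sub_left, inner_smul_left,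
          ContinuousLinearMap.star_eq_adjoint, ContinuousLinearMap.adjoint_inner_left,
          inner_self_eq_norm_sq_to_K]
        simp [h1, ← Complex.ofReal_pow]
        linarith
    obtain ⟨Y, hY⟩ := CStarAlgebra.nonneg_iff_eq_star_mul_self.mp hpos
    refine ⟨Matrix.of fun _ _ => Y, ?_⟩
    ext1 i j
    simp [Matrix.mul_apply, hD, hY]

lemma Unc.isUCP_restr {n : ℕ} {B : Type*} [CStarAlgebra B] (π : Unc n →⋆ₐ[ℂ] B) :
    (V n).IsUCP (restr (π : Unc n →ₗ[ℂ] B)) where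
  map_one := map_one π
  matPos p X := by
    rintro ⟨Y, hY⟩
    refine ⟨Y.map π, ?_⟩
    rw [← Matrix.conjTranspose_map π (fun x => map_star π x), ← Matrix.map_mul, ← hY]
    rfl

/-- Each matched pair and each adjoint pair contributes 1, giving `2 - 2 - 2`. -/
lemma pairState_sepElem {n m : ℕ} {r j₀ j₁ : Fin n} {k₀ k₁ c : Fin m} (hj : j₀ ≠ j₁)
    (hk : k₀ ≠ k₁) (K : PairCoeff (r, j₀) (r, j₁)) (K' : PairCoeff (k₀, c) (k₁, c)) :
    pairState K K' (sepElem r j₀ j₁ k₀ k₁ c) = -2 := by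
  simp only [sepElem, map_sub, map_add, map_smul, pairState_u, pairState_star_u,
    (isState_pairState hj hk K K').map_unit]
  simp [hj, hk, hj.symm, hk.symm]
  norm_num

end UnitaryCorr

theorem mainTheorem10 (n m : ℕ) (hn : 2 ≤ n) (hm : 2 ≤ m) :
    UnitaryCorr.Bqc n m ≠ UnitaryCorr.Bqmax n m ∧
    UnitaryCorr.commTensor (UnitaryCorr.V n) (UnitaryCorr.V m) ≠
      UnitaryCorr.maxTensor (UnitaryCorr.V n) (UnitaryCorr.V m) ∧
    ¬ UnitaryCorr.IsKPositive 1
      (UnitaryCorr.commTensor (UnitaryCorr.V n) (UnitaryCorr.V m))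
      (UnitaryCorr.maxTensor (UnitaryCorr.V n) (UnitaryCorr.V m)) LinearMap.id := by
  open UnitaryCorr in
  obtain ⟨j₀, j₁, hj⟩ : ∃ j₀ j₁ : Fin n, j₀ ≠ j₁ :=
    ⟨⟨0, by omega⟩, ⟨1, by omega⟩, by simp⟩
  obtain ⟨k₀, k₁, hk⟩ : ∃ k₀ k₁ : Fin m, k₀ ≠ k₁ :=
    ⟨⟨0, by omega⟩, ⟨1, by omega⟩, by simp⟩
  obtain ⟨K⟩ := PairCoeff.nonempty (j₀, j₀) (j₀, j₁)
  obtain ⟨K'⟩ := PairCoeff.nonempty (k₀, k₀) (k₁, k₀)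
  have hs := isState_pairState hj hk K K'
  have hnot : ¬ IsKPositive 1 (commTensor (V n) (V m)) (maxTensor (V n) (V m)) LinearMap.id := by
    intro h
    have h0 := hs.nonneg _ (h _ (sepElem_mem_commTensor j₀ hj hk k₀))
    simp only [Matrix.map_apply, Matrix.of_apply, LinearMap.id_apply,
      pairState_sepElem hj hk K K'] at h0
    have := (Complex.le_def.mp h0).1
    norm_num at this
  refine ⟨fun heq => ?_, fun heq => hnot fun X hX => ?_, hnot⟩
  · have hmem : (fun p q => pairState K K' (V.u p.1 p.2 ⊗ₜ V.u q.1 q.2)) ∈ Bqmax n m :=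
      ⟨pairState K K', hs, fun _ _ _ _ => rfl⟩
    rw [← heq] at hmem
    obtain ⟨H, _, _, _, A, B, ξ, hA, hA', hB, hB', -, hξ, hx⟩ := hmem
    obtain ⟨π, hπ, -⟩ := Unc.universal A hA hA'
    obtain ⟨σ, hσ, -⟩ := Unc.universal B hB hB'
    -- For a correlation in `Bqc` the two chosen values have real parts summing to at most `‖ξ‖² =
    -- 1`, whereas both are 1 for `pairState`.
    have h := re_inner_row_mul_col_le (Unc.isUCP_restr π) (Unc.isUCP_restr σ) j₀ hj hk k₀ ξ
    have e : ∀ i j k l, restr (π : Unc n →ₗ[ℂ] (H →L[ℂ] H)) (V.u i j) *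
        restr (σ : Unc m →ₗ[ℂ] (H →L[ℂ] H)) (V.u k l) = A i j * B k l :=
      fun i j k l => congrArg₂ _ (hπ i j) (hσ k l)
    rw [e, e, ← hx, ← hx, hξ] at h
    simp only [pairState_u] at h
    simp [hj, hk, hj.symm, hk.symm] at h
    norm_num at h
  · rw [← heq]
    simpa using hX

end
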